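/- Let $U$ and $V$ be linear subspaces of $\mathbb{R}^n$ with $1\le \dim U\le \dim V\le n-1$, and let $P_U,P_V,P_{U\cap V}$ denote the orthogonal projections. The Friedrichs angle $\theta_F\in(0,\frac{\pi}{2}]$ between $U$ and $V$ is given by $$\cos\theta_F=\max\{\langle u,v\rangle : u\in U\cap(U\cap V)^\perp,\ v\in V\cap(U\cap V)^\perp,\ \|u\|=\|v\|=1\},$$ with the convention $\cos\theta_F=0$ if this set is empty (i.e. if $U\subseteq V$). For $\mu\in\mathbb{R}$ put $T_\mu=(1-\mu)\,\mathrm{Id}+\mu P_UP_V$. A linear map $A$ on $\mathbb{R}^n$ is *convergent to* $A^\infty$ if $\|A^k-A^\infty\|\to0$ as $k\to\infty$, and *convergent* if it is convergent to some $A^\infty$. It is *linearly convergent to $A^\infty$ with rate* $r\in[0,1)$ if there are $M,N>0$ with $\|A^k-A^\infty\|\le Mr^k$ for all integers $k>N$; then $r$ is called a *convergence rate* of $A$. If the set of all convergence rates of $A$ has a least element, this is the *optimal convergence rate* of $A$. Finally $\gamma(A)=\max\{|\lambda| : \lambda\in\{0\}\cup(\sigma(A)\setminus\{1\})\}$, where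 $\sigma(A)\subset\mathbb{C}$ is the set of complex eigenvalues of $A$. **Theorem (relaxed alternating projection).** $T_\mu$ is convergent if and only if $\mu\in[0,2)$. Moreover: (i) If $\mu\in\bigl(0,\frac{2}{1+\sin^2\theta_F}\bigr]$, then $T_\mu$ is convergent to $P_{U\cap V}$ with optimal convergence rate $\gamma(T_\mu)=1-\mu\sin^2\theta_F$. (ii) If $\mu\in\bigl(\frac{2}{1+\sin^2\theta_F},2\bigr)$, then $T_\mu$ is convergent to $P_{U\cap V}$ with optimal convergence rate $\gamma(T_\mu)=\mu-1$. Consequently, for $\mu\neq0$, $T_\mu$ is linearly convergent to $P_{U\cap V}$ with some rate smaller than $\cos^2\theta_F$ if and only if $\mu\in(1,2-\sin^2\theta_F)$. Furthermore, the optimal convergence rate of $T_\mu$ at $\mu=\frac{2}{1+\sin^2\theta_F}$ is $\frac{1-\sin^2\theta_F}{1+\sin^2\theta_F}$, and every convergence rate of $T_\mu$, for any $\mu\neq0$, is at least this number. -/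

import Mathlib

open scoped Topology InnerProductSpace

noncomputable section

/-- `A` is convergent to `L`: `‖A ^ k - L‖ → 0` as `k → ∞`. -/
def PowersConvergeTo {R : Type*} [NormedRing R] (A L : R) : Prop :=
  Filter.Tendsto (fun k : ℕ => ‖A ^ k - L‖) Filter.atTop (𝓝 0)

/-- `A` is convergent: its powers converge to some limit. -/
def PowersConvergent {R : Type*} [NormedRing R] (A : R) : Prop :=
  ∃ L : R, PowersConvergeTo A L

/-- `A` is linearly convergent to `L` with rate `r ∈ [0, 1)`. -/
def LinearlyConvergesTo {R : Type*} [NormedRing R] (A L : R) (r : ℝ) : Prop :=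
  r ∈ Set.Ico (0 : ℝ) 1 ∧
    ∃ M N : ℝ, 0 < M ∧ 0 < N ∧ ∀ k : ℕ, N < (k : ℝ) → ‖A ^ k - L‖ ≤ M * r ^ k

/-- `r` is a convergence rate of `A`. -/
def IsConvergenceRate {R : Type*} [NormedRing R] (A : R) (r : ℝ) : Prop :=
  ∃ L : R, LinearlyConvergesTo A L r

/-- `r` is the optimal convergence rate of `A`: the infimum of all convergence rates of `A`,
which is itself a convergence rate. -/
def IsOptimalConvergenceRate {R : Type*} [NormedRing R] (A : R) (r : ℝ) : Prop :=
  IsLeast {t : ℝ | IsConvergenceRate A t} r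

/-- The set of all complex eigenvalues of a real operator. -/
def complexEigenvalues {n : ℕ}
    (A : EuclideanSpace ℝ (Fin n) →L[ℝ] EuclideanSpace ℝ (Fin n)) : Set ℂ :=
  {z : ℂ | Module.End.HasEigenvalue
    (LinearMap.baseChange ℂ (A : EuclideanSpace ℝ (Fin n) →ₗ[ℝ] EuclideanSpace ℝ (Fin n))) z}

/-- `γ(A) = max {|z| : z ∈ {0} ∪ σ(A) \ {1}}`, the modulus of the subdominant eigenvalues. -/
def subdominantModulus {n : ℕ}
    (A : EuclideanSpace ℝ (Fin n) →L[ℝ] EuclideanSpace ℝ (Fin n)) : ℝ :=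
  sSup ((fun z : ℂ => ‖z‖) '' ({0} ∪ complexEigenvalues A \ {1}))

/-- The supremum in the definition of `subdominantModulus` is a maximum. -/
theorem subdominantModulus_isGreatest {n : ℕ}
    (A : EuclideanSpace ℝ (Fin n) →L[ℝ] EuclideanSpace ℝ (Fin n)) :
    IsGreatest ((fun z : ℂ => ‖z‖) '' ({0} ∪ complexEigenvalues A \ {1}))
      (subdominantModulus A) := by
  have hfin : (complexEigenvalues A).Finite := Module.End.finite_hasEigenvalue _
  have hfin' : ((fun z : ℂ => ‖z‖) '' ({0} ∪ complexEigenvalues A \ {1})).Finite :=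
    ((Set.finite_singleton (0 : ℂ)).union hfin.sdiff).image _
  have hne : ((fun z : ℂ => ‖z‖) '' ({0} ∪ complexEigenvalues A \ {1})).Nonempty :=
    ⟨_, 0, Or.inl rfl, rfl⟩
  exact ⟨hne.csSup_mem hfin', fun x hx => le_csSup hfin'.bddAbove hx⟩

/-- The cosine `c_F(U, V)` of the Friedrichs angle. In finite dimension the supremum is a maximum
unless the set is empty (one subspace contains the other); then `c_F(U, V) = 0`, the usual
convention, since the supremum of the empty set of reals is `0`. -/
def friedrichsCos {n : ℕ} (U V : Submodule ℝ (EuclideanSpace ℝ (Fin n))) : ℝ :=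
  sSup {c : ℝ | ∃ u ∈ U ⊓ (U ⊓ V)ᗮ, ∃ v ∈ V ⊓ (U ⊓ V)ᗮ,
    ‖u‖ = 1 ∧ ‖v‖ = 1 ∧ c = ⟪u, v⟫_ℝ}

/-- The Friedrichs angle `θ_F` between `U` and `V`. -/
def friedrichsAngle {n : ℕ} (U V : Submodule ℝ (EuclideanSpace ℝ (Fin n))) : ℝ :=
  Real.arccos (friedrichsCos U V)

/-- The relaxed alternating projection mapping `T_μ = (1 - μ) Id + μ P_U P_V`. -/
def relaxedAltProj {n : ℕ} (U V : Submodule ℝ (EuclideanSpace ℝ (Fin n))) (μ : ℝ) :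
    EuclideanSpace ℝ (Fin n) →L[ℝ] EuclideanSpace ℝ (Fin n) :=
  (1 - μ) • ContinuousLinearMap.id ℝ (EuclideanSpace ℝ (Fin n)) +
    μ • (U.starProjection ∘L V.starProjection)

end

/-! Write c = cos θ_F and s = 1 - c² = sin² θ_F. The product P_U P_V is not symmetric in general,
but it is diagonalizable over ℝ (`iSup_eigenspace_starProjection_comp`). Its fixed space is U ∩ V,
and all its other eigenvalues lie in [0, c²] (`eigenvalue_starProjection_comp_mem`). Both endpoints
occur: 0 because V is proper, c² because a maximizing pair in the definition of c is mapped to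
multiples of itself by the projections.

For μ ≠ 0 the map T_μ has the same eigenvectors, with eigenvalues 1 - μ + μt. Apart from 1 they lie
between 1 - μ and 1 - μs, and both of these occur, so the subdominant modulus is max(|1 - μ|, |1 -
μs|). For a diagonalizable map with this modulus below 1, it is a convergence rate, and eigenvectors
show that no smaller rate is possible. The rest is the study of this maximum as a function of μ. -/

lemma mem_complexEigenvalues_of_hasEigenvalue {n : ℕ}
    {A : EuclideanSpace ℝ (Fin n) →L[ℝ] EuclideanSpace ℝ (Fin n)} {t : ℝ}
    (h : Module.End.HasEigenvalue
      (A : EuclideanSpace ℝ (Fin n) →ₗ[ℝ] EuclideanSpace ℝ (Fin n)) t) :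
    (t : ℂ) ∈ complexEigenvalues A := by
  rw [Module.End.hasEigenvalue_iff_isRoot_charpoly] at h
  change Module.End.HasEigenvalue _ _
  rw [Module.End.hasEigenvalue_iff_isRoot_charpoly, LinearMap.charpoly_baseChange]
  exact h.map (f := algebraMap ℝ ℂ)

/-- An endomorphism whose eigenspaces span the whole space is annihilated by a product of
distinct linear factors over its eigenvalues. -/
lemma aeval_prod_eigenvalues_eq_zero {K M : Type*} [Field K] [AddCommGroup M] [Module K M]
    [FiniteDimensional K M] (f : Module.End K M) (s : Finset K)
    (hs : ∀ t, f.HasEigenvalue t → t ∈ s) (htop : ⨆ t : K, f.eigenspace t = ⊤) :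
    Polynomial.aeval f (∏ t ∈ s, (Polynomial.X - Polynomial.C t)) = 0 := by
  rw [← LinearMap.ker_eq_top, eq_top_iff, ← htop, iSup_le_iff]
  intro t x hx
  rcases eq_or_ne x 0 with rfl | hx0
  · exact Submodule.zero_mem _
  have hv : f.HasEigenvector t x := ⟨hx, hx0⟩
  rw [LinearMap.mem_ker, Module.End.aeval_apply_of_hasEigenvector hv, Polynomial.eval_prod,
    Finset.prod_eq_zero (hs t (Module.End.hasEigenvalue_of_hasEigenvector hv)) (by simp), zero_smul]

/-- A product of real linear factors annihilates `A`, hence also its complexification; the complex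
minimal polynomial divides it, so its roots are real eigenvalues of `A`. -/
lemma exists_real_of_mem_complexEigenvalues {n : ℕ}
    {A : EuclideanSpace ℝ (Fin n) →L[ℝ] EuclideanSpace ℝ (Fin n)}
    (htop : ⨆ t : ℝ, Module.End.eigenspace
      (A : EuclideanSpace ℝ (Fin n) →ₗ[ℝ] EuclideanSpace ℝ (Fin n)) t = ⊤)
    {z : ℂ} (hz : z ∈ complexEigenvalues A) :
    ∃ t : ℝ, Module.End.HasEigenvalue
      (A : EuclideanSpace ℝ (Fin n) →ₗ[ℝ] EuclideanSpace ℝ (Fin n)) t ∧ z = t := by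
  have hfin := Module.End.finite_hasEigenvalue
    (A : EuclideanSpace ℝ (Fin n) →ₗ[ℝ] EuclideanSpace ℝ (Fin n))
  set p : Polynomial ℝ := ∏ t ∈ hfin.toFinset, (Polynomial.X - Polynomial.C t) with hp
  have h0 := aeval_prod_eigenvalues_eq_zero _ hfin.toFinset
    (fun t ht => hfin.mem_toFinset.2 ht) htop
  have h1 : Polynomial.aeval (LinearMap.baseChange ℂ
      (A : EuclideanSpace ℝ (Fin n) →ₗ[ℝ] EuclideanSpace ℝ (Fin n)))
      (p.map (algebraMap ℝ ℂ)) = 0 := by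
    rw [Polynomial.aeval_map_algebraMap]
    have h2 := Polynomial.aeval_algHom_apply
      (Module.End.baseChangeHom ℝ ℂ (EuclideanSpace ℝ (Fin n)))
      (A : EuclideanSpace ℝ (Fin n) →ₗ[ℝ] EuclideanSpace ℝ (Fin n)) p
    rw [h0, map_zero] at h2
    exact h2
  have h3 := (Module.End.isRoot_of_hasEigenvalue hz).dvd (minpoly.dvd ℂ _ h1)
  rw [hp, Polynomial.map_prod, Polynomial.IsRoot, Polynomial.eval_prod,
    Finset.prod_eq_zero_iff] at h3
  obtain ⟨t, ht, h⟩ := h3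
  refine ⟨t, hfin.mem_toFinset.1 ht, ?_⟩
  simpa [sub_eq_zero] using h

/-- Shifting the index shows that the limit satisfies a = a * l. -/
lemma tendsto_pow_imp {l a : ℝ} (h : Filter.Tendsto (fun k : ℕ => l ^ k) Filter.atTop (𝓝 a)) :
    (l = 1 ∧ a = 1) ∨ (|l| < 1 ∧ a = 0) := by
  have h1 := (Filter.tendsto_add_atTop_iff_nat 1).2 h
  have h2 : Filter.Tendsto (fun k : ℕ => l ^ (k + 1)) Filter.atTop (𝓝 (a * l)) := by
    simpa [pow_succ] using h.mul_const l
  have h3 : a * (l - 1) = 0 := by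
    linarith [tendsto_nhds_unique h1 h2]
  rcases mul_eq_zero.1 h3 with rfl | h4
  · exact Or.inr ⟨tendsto_pow_atTop_nhds_zero_iff.1 h, rfl⟩
  · have hl : l = 1 := by linarith
    subst hl
    exact Or.inl ⟨rfl, tendsto_nhds_unique h (by simp)⟩

/-! ### Powers of operators, eigenvalues and convergence rates -/

section Powers

variable {E : Type*} [NormedAddCommGroup E] [InnerProductSpace ℝ E]

lemma pow_apply_eigenvector {A : E →L[ℝ] E} {l : ℝ} {x : E} (hx : A x = l • x) (k : ℕ) :
    (A ^ k) x = l ^ k • x := by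
  induction k with
  | zero => simp
  | succ k ih => rw [pow_succ', mul_apply_eq_comp, ih, map_smul, hx, smul_smul, pow_succ]

/-- An eigenvalue of an operator with convergent powers is `1` or has modulus less than one, and
in the latter case the limit kills the eigenvectors. -/
lemma PowersConvergeTo.eigenvalue {A L : E →L[ℝ] E} (h : PowersConvergeTo A L) {l : ℝ} {x : E}
    (hx0 : x ≠ 0) (hx : A x = l • x) : l = 1 ∨ (|l| < 1 ∧ L x = 0) := by
  have h1 : Filter.Tendsto (fun k : ℕ => A ^ k) Filter.atTop (𝓝 L) :=
    tendsto_iff_norm_sub_tendsto_zero.2 h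
  have h2 : Filter.Tendsto (fun k : ℕ => (A ^ k) x) Filter.atTop (𝓝 (L x)) :=
    ((ContinuousLinearMap.apply ℝ E x).continuous.tendsto L).comp h1
  have hn : ⟪x, x⟫_ℝ ≠ 0 := by simpa using hx0
  -- Pairing with `x` reduces the convergence of `l ^ k • x` to that of the scalars `l ^ k`.
  have h3 : Filter.Tendsto (fun k : ℕ => l ^ k) Filter.atTop (𝓝 (⟪x, L x⟫_ℝ / ⟪x, x⟫_ℝ)) := by
    have h4 := (((innerSL ℝ x).continuous.tendsto (L x)).comp h2).div_const ⟪x, x⟫_ℝ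
    refine h4.congr fun k => ?_
    simp only [Function.comp, innerSL_apply_apply, pow_apply_eigenvector hx, inner_smul_right]
    field_simp
  rcases tendsto_pow_imp h3 with h5 | h5
  · exact Or.inl h5.1
  · refine Or.inr ⟨h5.1, tendsto_nhds_unique h2 ?_⟩
    have := (tendsto_pow_atTop_nhds_zero_of_abs_lt_one h5.1).smul_const x
    simpa [pow_apply_eigenvector hx] using this

lemma LinearlyConvergesTo.powersConvergeTo {R : Type*} [NormedRing R] {A L : R} {r : ℝ}
    (h : LinearlyConvergesTo A L r) : PowersConvergeTo A L := by
  obtain ⟨⟨hr0, hr1⟩, M, N, -, -, hk⟩ := h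
  have h1 : Filter.Tendsto (fun k : ℕ => M * r ^ k) Filter.atTop (𝓝 0) := by
    simpa using (tendsto_pow_atTop_nhds_zero_of_lt_one hr0 hr1).const_mul M
  refine squeeze_zero' (Filter.Eventually.of_forall fun k => norm_nonneg _) ?_ h1
  filter_upwards [Filter.eventually_gt_atTop ⌈N⌉₊] with k hkN
  exact hk k (Nat.lt_of_ceil_lt hkN)

/-- If `a ^ k` is eventually bounded by a constant times `r ^ k`, then `a ≤ r`. -/
lemma le_of_pow_le_const_mul_pow {a r M : ℝ} (hr : 0 ≤ r)
    (h : ∀ᶠ k : ℕ in Filter.atTop, a ^ k ≤ M * r ^ k) : a ≤ r := by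
  by_contra! hlt
  have ha : 0 < a := hr.trans_lt hlt
  have h1 : Filter.Tendsto (fun k : ℕ => M * (r / a) ^ k) Filter.atTop (𝓝 0) := by
    simpa using (tendsto_pow_atTop_nhds_zero_of_lt_one (by positivity)
      ((div_lt_one ha).2 hlt)).const_mul M
  obtain ⟨k, hk1, hk2⟩ := (h.and (h1.eventually (gt_mem_nhds one_pos))).exists
  rw [div_pow, ← mul_div_assoc, div_lt_one (by positivity)] at hk2
  linarith

/-- A convergence rate dominates the moduli of all eigenvalues different from one. -/
lemma IsConvergenceRate.abs_eigenvalue_le {A : E →L[ℝ] E} {r : ℝ} (h : IsConvergenceRate A r)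
    {l : ℝ} {x : E} (hl : l ≠ 1) (hx0 : x ≠ 0) (hx : A x = l • x) : |l| ≤ r := by
  obtain ⟨L, hL⟩ := h
  have hLx := ((hL.powersConvergeTo.eigenvalue hx0 hx).resolve_left hl).2
  obtain ⟨⟨hr0, -⟩, M, N, -, -, hk⟩ := hL
  refine le_of_pow_le_const_mul_pow (M := M) hr0 ?_
  filter_upwards [Filter.eventually_gt_atTop ⌈N⌉₊] with k hkN
  have h1 := ((A ^ k - L).le_opNorm x).trans
    (mul_le_mul_of_nonneg_right (hk k (Nat.lt_of_ceil_lt hkN)) (norm_nonneg x))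
  rw [sub_apply, hLx, sub_zero, pow_apply_eigenvector hx, norm_smul, norm_pow,
    Real.norm_eq_abs] at h1
  exact le_of_mul_le_mul_right h1 (norm_pos_iff.2 hx0)

/-- In finite dimension, pointwise bounds `‖B k x‖ ≤ M x * g k` are uniform. -/
lemma exists_norm_le_of_pointwise [FiniteDimensional ℝ E] (B : ℕ → E →L[ℝ] E) (g : ℕ → ℝ)
    (hg : ∀ k, 0 ≤ g k) (h : ∀ x, ∃ M, ∀ k, ‖B k x‖ ≤ M * g k) :
    ∃ M, 0 < M ∧ ∀ k, ‖B k‖ ≤ M * g k := by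
  choose M hM using h
  let b := stdOrthonormalBasis ℝ E
  -- The sum over the basis already bounds the norm; the `+ 1` only makes the constant positive.
  refine ⟨∑ i, |M (b i)| + 1, by positivity, fun k => ?_⟩
  refine ContinuousLinearMap.opNorm_le_bound _ (mul_nonneg (by positivity) (hg k)) fun x => ?_
  calc ‖B k x‖ = ‖∑ i, ⟪b i, x⟫_ℝ • B k (b i)‖ := by
        conv_lhs => rw [← b.sum_repr' x]
        simp
    _ ≤ ∑ i, ‖x‖ * (|M (b i)| * g k) := by
        refine norm_sum_le_of_le _ fun i _ => ?_
        rw [norm_smul]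
        refine mul_le_mul ?_ ((hM _ k).trans ?_) (norm_nonneg _) (norm_nonneg _)
        · simpa using norm_inner_le_norm (𝕜 := ℝ) (b i) x
        · exact mul_le_mul_of_nonneg_right (le_abs_self _) (hg k)
    _ = (∑ i, |M (b i)|) * g k * ‖x‖ := by
        rw [← Finset.mul_sum, ← Finset.sum_mul]; ring
    _ ≤ _ := by
        have := hg k
        gcongr
        linarith

/-- A diagonalizable operator whose eigenvalues other than one are at most `r < 1` in modulus
converges linearly with rate `r`. -/
lemma linearlyConvergesTo_of_eigenvectors [FiniteDimensional ℝ E] {A L : E →L[ℝ] E} {r : ℝ}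
    (hr : r ∈ Set.Ico (0 : ℝ) 1)
    (htop : ⨆ t : ℝ, Module.End.eigenspace (A : E →ₗ[ℝ] E) t = ⊤)
    (h1 : ∀ x, A x = x → L x = x)
    (h2 : ∀ (t : ℝ) x, t ≠ 1 → x ≠ 0 → A x = t • x → |t| ≤ r ∧ L x = 0) :
    LinearlyConvergesTo A L r := by
  have hpt : ∀ x, ∃ M, ∀ k, ‖(A ^ k - L) x‖ ≤ M * r ^ k := by
    intro x
    have hx : x ∈ ⨆ t : ℝ, Module.End.eigenspace (A : E →ₗ[ℝ] E) t := htop ▸ Submodule.mem_top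
    induction hx using Submodule.iSup_induction' with
    | zero => exact ⟨0, by simp⟩
    | add x y _ _ hx hy =>
      obtain ⟨M, hM⟩ := hx
      obtain ⟨M', hM'⟩ := hy
      refine ⟨M + M', fun k => ?_⟩
      rw [map_add, add_mul]
      exact norm_add_le_of_le (hM k) (hM' k)
    | mem t x hx =>
      have hx' : A x = t • x := Module.End.mem_eigenspace_iff.1 hx
      rcases eq_or_ne x 0 with rfl | hx0
      · exact ⟨0, by simp⟩
      rcases eq_or_ne t 1 with rfl | ht
      · refine ⟨0, fun k => ?_⟩
        simp [pow_apply_eigenvector hx', h1 x (by simpa using hx')]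
      · obtain ⟨h3, h4⟩ := h2 t x ht hx0 hx'
        refine ⟨‖x‖, fun k => ?_⟩
        rw [sub_apply, h4, sub_zero, pow_apply_eigenvector hx', norm_smul,
          norm_pow, Real.norm_eq_abs, mul_comm]
        gcongr
  obtain ⟨M, hM0, hM⟩ := exists_norm_le_of_pointwise (fun k => A ^ k - L) (fun k => r ^ k)
    (fun k => pow_nonneg hr.1 k) hpt
  exact ⟨hr, M, 1, hM0, one_pos, fun k _ => hM k⟩

end Powers

/-! ### Spectral structure of the product of two projections -/

section AlternatingProjection

variable {E : Type*} [NormedAddCommGroup E] [InnerProductSpace ℝ E] [FiniteDimensional ℝ E]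

/-- The product of two orthogonal projections is diagonalizable. -/
lemma iSup_eigenspace_starProjection_comp (U V : Submodule ℝ E) :
    ⨆ t : ℝ, Module.End.eigenspace
      ((U.starProjection ∘L V.starProjection : E →L[ℝ] E) : E →ₗ[ℝ] E) t = ⊤ := by
  set A : E →ₗ[ℝ] E := ((U.starProjection ∘L V.starProjection : E →L[ℝ] E) : E →ₗ[ℝ] E) with hA
  have hAx : ∀ x, A x = U.starProjection (V.starProjection x) := fun x => rfl
  set S : E →ₗ[ℝ] E :=
    ((U.starProjection ∘L V.starProjection ∘L U.starProjection : E →L[ℝ] E) : E →ₗ[ℝ] E) with hS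
  have hSx : ∀ x, S x = A (U.starProjection x) := fun x => rfl
  have hsymm : S.IsSymmetric := fun x y => by
    simp [hSx, hAx, Submodule.inner_starProjection_left_eq_right]
  set W := ⨆ t : ℝ, Module.End.eigenspace A t with hW
  -- `S` = P_U P_V P_U is symmetric, hence diagonalizable. Its eigenvectors for nonzero eigenvalues
  -- lie in `U`, where `S` and `A` agree, so they are eigenvectors of `A`.
  have hSW : ∀ x, ∃ w ∈ W, A w = S x := by
    intro x
    have hx : x ∈ ⨆ t : ℝ, Module.End.eigenspace S t := by
      have h := hsymm.orthogonalComplement_iSup_eigenspaces_eq_bot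
      rw [Submodule.orthogonal_eq_bot_iff] at h
      exact h ▸ Submodule.mem_top
    induction hx using Submodule.iSup_induction' with
    | zero => exact ⟨0, W.zero_mem, by simp⟩
    | add x y _ _ hx hy =>
      obtain ⟨w, hw, hwx⟩ := hx
      obtain ⟨w', hw', hwy⟩ := hy
      exact ⟨w + w', W.add_mem hw hw', by rw [map_add, map_add, hwx, hwy]⟩
    | mem t x hx =>
      have hx' : S x = t • x := Module.End.mem_eigenspace_iff.1 hx
      rcases eq_or_ne t 0 with rfl | ht
      · exact ⟨0, W.zero_mem, by simp [hx']⟩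
      have hxU : x ∈ U := by
        have h1 : t • x ∈ U := hx' ▸ U.starProjection_apply_mem _
        exact (U.smul_mem_iff ht).1 h1
      have hAS : A x = S x := by
        rw [hSx, Submodule.starProjection_eq_self_iff.2 hxU]
      exact ⟨x, Submodule.mem_iSup_of_mem t
        (Module.End.mem_eigenspace_iff.2 (hAS.trans hx')), hAS⟩
  have hker : ∀ x, A x = 0 → x ∈ W := fun x hx =>
    Submodule.mem_iSup_of_mem 0 (Module.End.mem_eigenspace_iff.2 (by simpa using hx))
  -- the range of `A` is contained in the range of `S`
  have hrange : ∀ x, ∃ y, S y = A x := by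
    -- If `y` is orthogonal to the range of `S`, then 0 = ⟪S y, y⟫ = ‖P_V P_U y‖², and P_V P_U is
    -- the adjoint of `A`.
    have hle : (LinearMap.range S)ᗮ ≤ (LinearMap.range A)ᗮ := by
      intro y hy
      rw [Submodule.mem_orthogonal] at hy ⊢
      rintro _ ⟨x, rfl⟩
      have h1 := hy _ ⟨y, rfl⟩
      have h2 : V.starProjection (U.starProjection y) = 0 := by
        rw [← inner_self_eq_zero (𝕜 := ℝ), Submodule.inner_starProjection_left_eq_right,
          Submodule.starProjection_eq_self_iff.2 (V.starProjection_apply_mem _), ← h1, hSx, hAx,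
          Submodule.inner_starProjection_left_eq_right, real_inner_comm]
      rw [hAx, Submodule.inner_starProjection_left_eq_right,
        Submodule.inner_starProjection_left_eq_right, h2, inner_zero_right]
    intro x
    exact Submodule.orthogonal_le_orthogonal_iff.1 hle ⟨x, rfl⟩
  rw [eq_top_iff]
  intro x _
  obtain ⟨y, hy⟩ := hrange x
  obtain ⟨w, hw, hwy⟩ := hSW y
  -- Some `w` in `W` has the same image as `x`, so `x` differs from it by an element of the kernel,
  -- the eigenspace for 0.
  have h1 : x - w ∈ W := hker _ (by rw [map_sub, hwy, hy, sub_self])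
  simpa using W.add_mem h1 hw

/-- Projections do not increase norms, and P_V preserves the norm of a vector only if it lies in
`V`. -/
lemma starProjection_comp_fixed_iff (U V : Submodule ℝ E) {x : E} :
    U.starProjection (V.starProjection x) = x ↔ x ∈ U ⊓ V := by
  constructor
  · intro h
    have h1 : ‖x‖ ≤ ‖V.starProjection x‖ := by
      conv_lhs => rw [← h]
      exact U.norm_starProjection_apply_le _
    have hV : x ∈ V := (V.mem_iff_norm_starProjection x).2
      (le_antisymm (V.norm_starProjection_apply_le x) h1)
    refine ⟨?_, hV⟩
    rw [Submodule.starProjection_eq_self_iff.2 hV] at h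
    exact Submodule.starProjection_eq_self_iff.1 h
  · rintro ⟨hU, hV⟩
    rw [Submodule.starProjection_eq_self_iff.2 hV, Submodule.starProjection_eq_self_iff.2 hU]

/-- Eigenvectors of `P_U P_V` for eigenvalues other than one are orthogonal to `U ⊓ V`. -/
lemma mem_orthogonal_inf_of_eigenvector {U V : Submodule ℝ E} {x : E} {t : ℝ} (ht : t ≠ 1)
    (hx : U.starProjection (V.starProjection x) = t • x) : x ∈ (U ⊓ V)ᗮ := by
  rw [Submodule.mem_orthogonal]
  intro w hw
  have h1 : ⟪w, t • x⟫_ℝ = ⟪w, x⟫_ℝ := by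
    rw [← hx, ← Submodule.inner_starProjection_left_eq_right,
      ← Submodule.inner_starProjection_left_eq_right,
      Submodule.starProjection_eq_self_iff.2 hw.1, Submodule.starProjection_eq_self_iff.2 hw.2]
  rw [inner_smul_right] at h1
  have h2 : (t - 1) * ⟪w, x⟫_ℝ = 0 := by linarith
  exact (mul_eq_zero.1 h2).resolve_left (sub_ne_zero.2 ht)

lemma starProjection_mem_orthogonal_inf {U V : Submodule ℝ E} {x : E} (hx : x ∈ (U ⊓ V)ᗮ) :
    V.starProjection x ∈ (U ⊓ V)ᗮ := by
  rw [Submodule.mem_orthogonal] at hx ⊢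
  intro w hw
  rw [← Submodule.inner_starProjection_left_eq_right, Submodule.starProjection_eq_self_iff.2 hw.2]
  exact hx w hw

end AlternatingProjection

/-! ### The Friedrichs angle and the eigenvalues of P_U P_V -/

section Friedrichs

variable {n : ℕ} (U V : Submodule ℝ (EuclideanSpace ℝ (Fin n)))

lemma bddAbove_friedrichs : BddAbove {c : ℝ | ∃ u ∈ U ⊓ (U ⊓ V)ᗮ, ∃ v ∈ V ⊓ (U ⊓ V)ᗮ,
    ‖u‖ = 1 ∧ ‖v‖ = 1 ∧ c = ⟪u, v⟫_ℝ} := by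
  refine ⟨1, ?_⟩
  rintro c ⟨u, -, v, -, hu, hv, rfl⟩
  simpa [hu, hv] using real_inner_le_norm u v

lemma friedrichsCos_nonneg : 0 ≤ friedrichsCos U V := by
  by_cases h : ∃ u ∈ U ⊓ (U ⊓ V)ᗮ, ∃ v ∈ V ⊓ (U ⊓ V)ᗮ, ‖u‖ = 1 ∧ ‖v‖ = 1
  · obtain ⟨u, hu, v, hv, hu1, hv1⟩ := h
    refine Real.sSup_nonneg' ?_
    rcases le_total 0 ⟪u, v⟫_ℝ with h0 | h0
    · exact ⟨_, ⟨u, hu, v, hv, hu1, hv1, rfl⟩, h0⟩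
    -- The set is symmetric under a change of sign of `u`.
    · exact ⟨_, ⟨-u, neg_mem hu, v, hv, by rwa [norm_neg], hv1, rfl⟩, by
        rw [inner_neg_left]; linarith⟩
  · refine Real.sSup_nonneg ?_
    rintro c ⟨u, hu, v, hv, hu1, hv1, -⟩
    exact absurd ⟨u, hu, v, hv, hu1, hv1⟩ h

variable {U V} in
lemma inner_le_friedrichsCos_mul {u v : EuclideanSpace ℝ (Fin n)} (hu : u ∈ U ⊓ (U ⊓ V)ᗮ)
    (hv : v ∈ V ⊓ (U ⊓ V)ᗮ) : ⟪u, v⟫_ℝ ≤ friedrichsCos U V * (‖u‖ * ‖v‖) := by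
  rcases eq_or_ne u 0 with rfl | hu0
  · simp
  rcases eq_or_ne v 0 with rfl | hv0
  · simp
  have hu1 := norm_pos_iff.2 hu0
  have hv1 := norm_pos_iff.2 hv0
  have h := le_csSup (bddAbove_friedrichs U V) ⟨‖u‖⁻¹ • u, Submodule.smul_mem _ _ hu,
    ‖v‖⁻¹ • v, Submodule.smul_mem _ _ hv, norm_smul_inv_norm hu0, norm_smul_inv_norm hv0, rfl⟩
  rw [inner_smul_left, inner_smul_right] at h
  change _ ≤ friedrichsCos U V at h
  rw [← div_le_iff₀ (by positivity)]
  refine le_of_eq_of_le ?_ h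
  simp
  field_simp

/-- The supremum defining the cosine of the Friedrichs angle is attained unless it is zero. -/
lemma exists_friedrichsCos_eq (h : friedrichsCos U V ≠ 0) :
    ∃ u ∈ U ⊓ (U ⊓ V)ᗮ, ∃ v ∈ V ⊓ (U ⊓ V)ᗮ,
      ‖u‖ = 1 ∧ ‖v‖ = 1 ∧ friedrichsCos U V = ⟪u, v⟫_ℝ := by
  set s : Set ℝ := {c : ℝ | ∃ u ∈ U ⊓ (U ⊓ V)ᗮ, ∃ v ∈ V ⊓ (U ⊓ V)ᗮ,
    ‖u‖ = 1 ∧ ‖v‖ = 1 ∧ c = ⟪u, v⟫_ℝ} with hs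
  have hne : s.Nonempty := by
    rw [Set.nonempty_iff_ne_empty]
    intro h0
    exact h (by rw [friedrichsCos, ← hs, h0, Real.sSup_empty])
  have himage : s = (fun p : EuclideanSpace ℝ (Fin n) × EuclideanSpace ℝ (Fin n) => ⟪p.1, p.2⟫_ℝ) ''
      ((((U ⊓ (U ⊓ V)ᗮ : Submodule ℝ _) : Set _) ∩ Metric.sphere 0 1) ×ˢ
        (((V ⊓ (U ⊓ V)ᗮ : Submodule ℝ _) : Set _) ∩ Metric.sphere 0 1)) := by
    ext c
    constructor
    · rintro ⟨u, hu, v, hv, hu1, hv1, rfl⟩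
      exact ⟨(u, v), ⟨⟨hu, by simpa using hu1⟩, ⟨hv, by simpa using hv1⟩⟩, rfl⟩
    · rintro ⟨⟨u, v⟩, ⟨⟨hu, hu1⟩, ⟨hv, hv1⟩⟩, rfl⟩
      exact ⟨u, hu, v, hv, by simpa using hu1, by simpa using hv1, rfl⟩
  have hcomp : IsCompact s := by
    rw [himage]
    refine IsCompact.image (IsCompact.prod ?_ ?_) (by fun_prop) <;>
    exact (isCompact_sphere _ _).inter_left (Submodule.closed_of_finiteDimensional _)
  exact hcomp.sSup_mem hne

/-- Equality in Cauchy–Schwarz for a maximizing pair would give a unit vector in both U ∩ V and its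
orthogonal complement. -/
lemma friedrichsCos_lt_one : friedrichsCos U V < 1 := by
  by_cases h : friedrichsCos U V = 0
  · rw [h]; exact one_pos
  obtain ⟨u, hu, v, hv, hu1, hv1, h1⟩ := exists_friedrichsCos_eq U V h
  rw [h1]
  refine lt_of_le_of_ne (by simpa [hu1, hv1] using real_inner_le_norm u v) fun h2 => ?_
  have huv : u = v := (inner_eq_one_iff_of_norm_eq_one hu1 hv1).1 h2
  subst huv
  have h3 := (Submodule.mem_orthogonal _ _).1 hu.2 u ⟨hu.1, hv.1⟩
  rw [h3] at h2
  exact zero_ne_one h2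

lemma cos_friedrichsAngle : Real.cos (friedrichsAngle U V) = friedrichsCos U V :=
  Real.cos_arccos (by linarith [friedrichsCos_nonneg U V]) (friedrichsCos_lt_one U V).le

lemma sin_sq_friedrichsAngle :
    Real.sin (friedrichsAngle U V) ^ 2 = 1 - friedrichsCos U V ^ 2 := by
  rw [Real.sin_sq, cos_friedrichsAngle]

variable {U V}

/-- For t ≠ 0 the eigenvector lies in U, so t‖x‖² = ⟪x, P_V x⟫ = ‖P_V x‖² ≥ 0. The Friedrichs bound
applied to x and P_V x gives ‖P_V x‖ ≤ c‖x‖, hence t ≤ c². -/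
lemma eigenvalue_starProjection_comp_mem {x : EuclideanSpace ℝ (Fin n)} {t : ℝ} (ht : t ≠ 1)
    (hx0 : x ≠ 0) (hx : U.starProjection (V.starProjection x) = t • x) :
    t ∈ Set.Icc 0 (friedrichsCos U V ^ 2) := by
  rcases eq_or_ne t 0 with rfl | ht0
  · exact ⟨le_rfl, sq_nonneg _⟩
  have hxU : x ∈ U := by
    have h1 : t • x ∈ U := hx ▸ U.starProjection_apply_mem _
    exact (U.smul_mem_iff ht0).1 h1
  have hxo := mem_orthogonal_inf_of_eigenvector ht hx
  have h1 : ⟪x, V.starProjection x⟫_ℝ = t * ‖x‖ ^ 2 := by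
    rw [← Submodule.starProjection_eq_self_iff.2 hxU, Submodule.inner_starProjection_left_eq_right,
      Submodule.starProjection_eq_self_iff.2 hxU, hx, inner_smul_right, real_inner_self_eq_norm_sq]
  have h2 : ⟪x, V.starProjection x⟫_ℝ = ‖V.starProjection x‖ ^ 2 := by
    rw [← real_inner_self_eq_norm_sq, Submodule.inner_starProjection_left_eq_right,
      Submodule.starProjection_eq_self_iff.2 (V.starProjection_apply_mem _)]
  have h3 := inner_le_friedrichsCos_mul (U := U) (V := V) ⟨hxU, hxo⟩
    ⟨V.starProjection_apply_mem x, starProjection_mem_orthogonal_inf hxo⟩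
  have hx1 : 0 < ‖x‖ ^ 2 := pow_pos (norm_pos_iff.2 hx0) 2
  refine ⟨?_, ?_⟩
  · by_contra! h
    nlinarith [sq_nonneg ‖V.starProjection x‖]
  · have h4 : ‖V.starProjection x‖ ≤ friedrichsCos U V * ‖x‖ := by
      rcases (norm_nonneg (V.starProjection x)).eq_or_lt with h0 | h0
      · rw [← h0]; exact mul_nonneg (friedrichsCos_nonneg U V) (norm_nonneg x)
      · refine le_of_mul_le_mul_right ?_ h0
        linarith
    have h5 := pow_le_pow_left₀ (norm_nonneg _) h4 2
    rw [mul_pow, ← h2, h1] at h5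
    exact le_of_mul_le_mul_right h5 hx1

variable (U V)

lemma exists_starProjection_comp_eq_zero (hV : Module.finrank ℝ V < n) :
    ∃ x : EuclideanSpace ℝ (Fin n), x ≠ 0 ∧ U.starProjection (V.starProjection x) = 0 := by
  have h : Vᗮ ≠ ⊥ := by
    rw [Ne, Submodule.orthogonal_eq_bot_iff]
    rintro rfl
    simp at hV
  obtain ⟨x, hx, hx0⟩ := Submodule.exists_mem_ne_zero_of_ne_bot h
  exact ⟨x, hx0, by rw [(Submodule.starProjection_apply_eq_zero_iff _).2 hx, map_zero]⟩

/-- The squared cosine of the Friedrichs angle is an eigenvalue of `P_U P_V`. -/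
lemma exists_starProjection_comp_eq_friedrichsCos_sq (hV : Module.finrank ℝ V < n) :
    ∃ x : EuclideanSpace ℝ (Fin n), x ≠ 0 ∧
      U.starProjection (V.starProjection x) = friedrichsCos U V ^ 2 • x := by
  by_cases h : friedrichsCos U V = 0
  · simpa [h] using exists_starProjection_comp_eq_zero U V hV
  obtain ⟨u, hu, v, hv, hu1, hv1, huv⟩ := exists_friedrichsCos_eq U V h
  set c := friedrichsCos U V with hc
  -- The hypotheses give ‖P_W a‖ ≤ c, whereas ‖P_W a - c b‖² = ‖P_W a‖² - c². Used twice, it yields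
  -- P_V u = c v and P_U v = c u for a maximizing pair.
  have key : ∀ (W : Submodule ℝ (EuclideanSpace ℝ (Fin n))) (a b : EuclideanSpace ℝ (Fin n)),
      b ∈ W → ‖b‖ = 1 → ⟪a, b⟫_ℝ = c → ⟪a, W.starProjection a⟫_ℝ ≤ c * ‖W.starProjection a‖ →
      W.starProjection a = c • b := by
    intro W a b hb hb1 hab hle
    have h1 : ⟪a, W.starProjection a⟫_ℝ = ‖W.starProjection a‖ ^ 2 := by
      rw [← real_inner_self_eq_norm_sq, Submodule.inner_starProjection_left_eq_right,
        Submodule.starProjection_eq_self_iff.2 (W.starProjection_apply_mem _)]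
    have h2 : ⟪W.starProjection a, b⟫_ℝ = c := by
      rw [Submodule.inner_starProjection_left_eq_right, Submodule.starProjection_eq_self_iff.2 hb,
        hab]
    have hc0 : 0 ≤ c := friedrichsCos_nonneg U V
    have h3 : ‖W.starProjection a‖ ≤ c := by
      by_contra! h4
      nlinarith
    have h4 : ‖W.starProjection a - c • b‖ ^ 2 = ‖W.starProjection a‖ ^ 2 - c ^ 2 := by
      rw [norm_sub_sq_real, inner_smul_right, h2, norm_smul, hb1, Real.norm_eq_abs, mul_one, sq_abs]
      ring
    have h5 := pow_le_pow_left₀ (norm_nonneg _) h3 2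
    have h6 : ‖W.starProjection a - c • b‖ ^ 2 = 0 := le_antisymm (by linarith) (sq_nonneg _)
    exact sub_eq_zero.1 (norm_eq_zero.1 (pow_eq_zero_iff two_ne_zero |>.1 h6))
  have h1 : V.starProjection u = c • v := by
    refine key V u v hv.1 hv1 huv.symm ?_
    have := inner_le_friedrichsCos_mul hu
      ⟨V.starProjection_apply_mem u, starProjection_mem_orthogonal_inf hu.2⟩
    rwa [hu1, one_mul] at this
  have h2 : U.starProjection v = c • u := by
    refine key U v u hu.1 hu1 (by rw [real_inner_comm, huv]) ?_
    have := inner_le_friedrichsCos_mul (U := U) (V := V)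
      ⟨U.starProjection_apply_mem v, by
        rw [inf_comm]; exact starProjection_mem_orthogonal_inf (by rw [inf_comm]; exact hv.2)⟩ hv
    rwa [hv1, mul_one, real_inner_comm] at this
  refine ⟨u, fun h0 => by simp [h0] at hu1, ?_⟩
  rw [h1, map_smul, h2, smul_smul, sq]

end Friedrichs

/-! ### The relaxed map and its rate as a function of μ -/

section Relaxed

variable {n : ℕ} {U V : Submodule ℝ (EuclideanSpace ℝ (Fin n))} {μ : ℝ}

lemma relaxedAltProj_apply (x : EuclideanSpace ℝ (Fin n)) :
    relaxedAltProj U V μ x = (1 - μ) • x + μ • U.starProjection (V.starProjection x) := rfl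

lemma relaxedAltProj_apply_of_eigenvector {x : EuclideanSpace ℝ (Fin n)} {t : ℝ}
    (hx : U.starProjection (V.starProjection x) = t • x) :
    relaxedAltProj U V μ x = (1 - μ + μ * t) • x := by
  rw [relaxedAltProj_apply, hx, smul_smul, add_smul]

lemma eigenvector_of_relaxedAltProj (hμ : μ ≠ 0) {x : EuclideanSpace ℝ (Fin n)} {l : ℝ}
    (hx : relaxedAltProj U V μ x = l • x) :
    U.starProjection (V.starProjection x) = ((l - (1 - μ)) / μ) • x := by
  rw [relaxedAltProj_apply, add_comm, ← eq_sub_iff_add_eq, ← sub_smul] at hx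
  rw [div_eq_inv_mul, mul_smul, ← hx, smul_smul, inv_mul_cancel₀ hμ, one_smul]

lemma iSup_eigenspace_relaxedAltProj :
    ⨆ t : ℝ, Module.End.eigenspace
      (relaxedAltProj U V μ : EuclideanSpace ℝ (Fin n) →ₗ[ℝ] EuclideanSpace ℝ (Fin n)) t = ⊤ := by
  rw [eq_top_iff, ← iSup_eigenspace_starProjection_comp U V, iSup_le_iff]
  intro t x hx
  exact Submodule.mem_iSup_of_mem (1 - μ + μ * t) (Module.End.mem_eigenspace_iff.2
    (relaxedAltProj_apply_of_eigenvector (Module.End.mem_eigenspace_iff.1 hx)))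

/-- The modulus of the subdominant eigenvalues of the relaxed alternating projection mapping, in
terms of the Friedrichs angle. -/
noncomputable def relaxedAltProjRate (U V : Submodule ℝ (EuclideanSpace ℝ (Fin n))) (μ : ℝ) : ℝ :=
  max |1 - μ| |1 - μ * (1 - friedrichsCos U V ^ 2)|

lemma friedrichsCos_sq_lt_one : friedrichsCos U V ^ 2 < 1 :=
  pow_lt_one₀ (friedrichsCos_nonneg U V) (friedrichsCos_lt_one U V) two_ne_zero

lemma relaxedAltProj_eigenvector_bound (hμ : μ ≠ 0) {x : EuclideanSpace ℝ (Fin n)} {l : ℝ}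
    (hl : l ≠ 1) (hx0 : x ≠ 0) (hx : relaxedAltProj U V μ x = l • x) :
    |l| ≤ relaxedAltProjRate U V μ ∧ (U ⊓ V).starProjection x = 0 := by
  have h := eigenvector_of_relaxedAltProj hμ hx
  set t := (l - (1 - μ)) / μ with ht
  have hlt : l = 1 - μ + μ * t := by rw [ht]; field_simp; ring
  have ht1 : t ≠ 1 := by
    rintro h1
    exact hl (by rw [hlt, h1]; ring)
  obtain ⟨ht0, htc⟩ := eigenvalue_starProjection_comp_mem ht1 hx0 h
  refine ⟨?_, (Submodule.starProjection_apply_eq_zero_iff _).2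
    (mem_orthogonal_inf_of_eigenvector ht1 h)⟩
  rw [relaxedAltProjRate, hlt]
  -- The eigenvalue is affine in `t`, so its modulus is largest at an end of [0, c²]; the sign of
  -- `μ` decides the order of the two end values.
  rcases le_total 0 μ with hμ0 | hμ0
  · refine (abs_le_max_abs_abs (a := 1 - μ) (c := 1 - μ * (1 - friedrichsCos U V ^ 2)) ?_ ?_)
    <;> nlinarith
  · rw [max_comm]
    refine (abs_le_max_abs_abs (a := 1 - μ * (1 - friedrichsCos U V ^ 2)) (c := 1 - μ) ?_ ?_)
    <;> nlinarith

lemma linearlyConvergesTo_relaxedAltProj (hμ : μ ∈ Set.Ioo (0 : ℝ) 2) :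
    LinearlyConvergesTo (relaxedAltProj U V μ) (U ⊓ V).starProjection
      (relaxedAltProjRate U V μ) := by
  have hc := friedrichsCos_sq_lt_one (U := U) (V := V)
  have hc0 := sq_nonneg (friedrichsCos U V)
  obtain ⟨h0, h2⟩ := hμ
  refine linearlyConvergesTo_of_eigenvectors ⟨le_max_of_le_left (abs_nonneg _), ?_⟩
    iSup_eigenspace_relaxedAltProj (fun x hx => ?_)
    fun t x ht hx0 hx => relaxedAltProj_eigenvector_bound h0.ne' ht hx0 hx
  · refine max_lt (abs_lt.2 ⟨by linarith, by linarith⟩) (abs_lt.2 ⟨?_, ?_⟩) <;> nlinarith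
  · have h := eigenvector_of_relaxedAltProj (l := 1) h0.ne' (by rw [hx, one_smul])
    rw [sub_sub_cancel, div_self h0.ne', one_smul, starProjection_comp_fixed_iff] at h
    exact Submodule.starProjection_eq_self_iff.2 h

lemma exists_eigenvector_relaxedAltProj (hV : Module.finrank ℝ V < n) :
    ∃ x : EuclideanSpace ℝ (Fin n), x ≠ 0 ∧ relaxedAltProj U V μ x = (1 - μ) • x := by
  obtain ⟨x, hx0, hx⟩ := exists_starProjection_comp_eq_zero U V hV
  exact ⟨x, hx0, by rw [relaxedAltProj_apply, hx, smul_zero, add_zero]⟩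

lemma exists_eigenvector_relaxedAltProj_friedrichs (hV : Module.finrank ℝ V < n) :
    ∃ x : EuclideanSpace ℝ (Fin n), x ≠ 0 ∧
      relaxedAltProj U V μ x = (1 - μ * (1 - friedrichsCos U V ^ 2)) • x := by
  obtain ⟨x, hx0, hx⟩ := exists_starProjection_comp_eq_friedrichsCos_sq U V hV
  refine ⟨x, hx0, ?_⟩
  rw [relaxedAltProj_apply_of_eigenvector hx]
  congr 1
  ring

lemma one_sub_ne_one (hμ : μ ≠ 0) : 1 - μ ≠ 1 := by simpa using hμ

lemma one_sub_mul_ne_one (hμ : μ ≠ 0) : 1 - μ * (1 - friedrichsCos U V ^ 2) ≠ 1 := by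
  have := friedrichsCos_sq_lt_one (U := U) (V := V)
  simp only [ne_eq, sub_eq_self, mul_eq_zero, not_or]
  exact ⟨hμ, by linarith⟩

lemma relaxedAltProjRate_le (hV : Module.finrank ℝ V < n) (hμ : μ ≠ 0) {r : ℝ}
    (hr : IsConvergenceRate (relaxedAltProj U V μ) r) : relaxedAltProjRate U V μ ≤ r := by
  obtain ⟨x, hx0, hx⟩ := exists_eigenvector_relaxedAltProj (U := U) (μ := μ) hV
  obtain ⟨y, hy0, hy⟩ := exists_eigenvector_relaxedAltProj_friedrichs (U := U) (μ := μ) hV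
  exact max_le (hr.abs_eigenvalue_le (one_sub_ne_one hμ) hx0 hx)
    (hr.abs_eigenvalue_le (one_sub_mul_ne_one hμ) hy0 hy)

lemma subdominantModulus_relaxedAltProj (hV : Module.finrank ℝ V < n) (hμ : μ ≠ 0) :
    subdominantModulus (relaxedAltProj U V μ) = relaxedAltProjRate U V μ := by
  have hgr := subdominantModulus_isGreatest (relaxedAltProj U V μ)
  apply le_antisymm
  · obtain ⟨z, hz, hzn⟩ := hgr.1
    rw [← hzn]
    rcases hz with rfl | ⟨hz, hz1⟩
    · refine (norm_zero (E := ℂ)).trans_le ?_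
      exact (abs_nonneg (1 - μ)).trans (le_max_left _ _)
    · obtain ⟨t, ht, rfl⟩ := exists_real_of_mem_complexEigenvalues
        iSup_eigenspace_relaxedAltProj hz
      obtain ⟨x, hx, hx0⟩ := ht.exists_hasEigenvector
      have := (relaxedAltProj_eigenvector_bound hμ (by rintro rfl; simp at hz1) hx0
        (Module.End.mem_eigenspace_iff.1 hx)).1
      simpa using this
  · have key : ∀ l : ℝ, l ≠ 1 → (∃ x : EuclideanSpace ℝ (Fin n), x ≠ 0 ∧
        relaxedAltProj U V μ x = l • x) → |l| ≤ subdominantModulus (relaxedAltProj U V μ) := by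
      rintro l hl ⟨x, hx0, hx⟩
      refine hgr.2 ⟨(l : ℂ), Or.inr ⟨mem_complexEigenvalues_of_hasEigenvalue
        (Module.End.hasEigenvalue_of_hasEigenvector
          ⟨Module.End.mem_eigenspace_iff.2 hx, hx0⟩), ?_⟩, by simp⟩
      simpa using hl
    exact max_le (key _ (one_sub_ne_one hμ) (exists_eigenvector_relaxedAltProj hV))
      (key _ (one_sub_mul_ne_one hμ) (exists_eigenvector_relaxedAltProj_friedrichs hV))

lemma isOptimalConvergenceRate_relaxedAltProj (hV : Module.finrank ℝ V < n)
    (hμ : μ ∈ Set.Ioo (0 : ℝ) 2) :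
    IsOptimalConvergenceRate (relaxedAltProj U V μ) (relaxedAltProjRate U V μ) :=
  ⟨⟨_, linearlyConvergesTo_relaxedAltProj hμ⟩, fun _ hr => relaxedAltProjRate_le hV hμ.1.ne' hr⟩

lemma PowersConvergent.mem_Ico (hV : Module.finrank ℝ V < n)
    (h : PowersConvergent (relaxedAltProj U V μ)) : μ ∈ Set.Ico (0 : ℝ) 2 := by
  obtain ⟨L, hL⟩ := h
  obtain ⟨x, hx0, hx⟩ := exists_eigenvector_relaxedAltProj (U := U) (μ := μ) hV
  rcases hL.eigenvalue hx0 hx with h | ⟨h, -⟩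
  · constructor <;> linarith
  · rw [abs_lt] at h
    constructor <;> linarith

lemma powersConvergent_relaxedAltProj_iff (hV : Module.finrank ℝ V < n) :
    PowersConvergent (relaxedAltProj U V μ) ↔ μ ∈ Set.Ico (0 : ℝ) 2 := by
  refine ⟨fun h => h.mem_Ico hV, fun ⟨h0, h2⟩ => ?_⟩
  rcases h0.eq_or_lt with rfl | h0
  · have h1 : relaxedAltProj U V 0 = 1 := by
      ext x
      simp [relaxedAltProj_apply]
    exact ⟨1, by simp [PowersConvergeTo, h1]⟩
  · exact ⟨_, (linearlyConvergesTo_relaxedAltProj ⟨h0, h2⟩).powersConvergeTo⟩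

/-- The threshold 2 / (1 + s) is the solution of μ - 1 = 1 - μs; up to it, 1 - μs is nonnegative and
dominates |1 - μ|. -/
lemma relaxedAltProjRate_eq_of_le (h0 : 0 < μ) (h : μ ≤ 2 / (1 + (1 - friedrichsCos U V ^ 2))) :
    relaxedAltProjRate U V μ = 1 - μ * (1 - friedrichsCos U V ^ 2) := by
  have hc := friedrichsCos_sq_lt_one (U := U) (V := V)
  have hc0 := sq_nonneg (friedrichsCos U V)
  rw [le_div_iff₀ (by linarith)] at h
  rw [relaxedAltProjRate, abs_of_nonneg (a := 1 - μ * _) (by nlinarith)]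
  exact max_eq_right (abs_le.2 ⟨by nlinarith, by nlinarith⟩)

lemma relaxedAltProjRate_eq_of_ge (h : 2 / (1 + (1 - friedrichsCos U V ^ 2)) ≤ μ) :
    relaxedAltProjRate U V μ = μ - 1 := by
  have hc := friedrichsCos_sq_lt_one (U := U) (V := V)
  have hc0 := sq_nonneg (friedrichsCos U V)
  rw [div_le_iff₀ (by linarith)] at h
  have h1 : 1 ≤ μ := by nlinarith
  rw [relaxedAltProjRate, abs_sub_comm, abs_of_nonneg (a := μ - 1) (by linarith)]
  exact max_eq_left (abs_le.2 ⟨by nlinarith, by nlinarith⟩)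

lemma exists_rate_lt_friedrichsCos_sq_iff (hV : Module.finrank ℝ V < n) (hμ : μ ≠ 0) :
    (∃ r < friedrichsCos U V ^ 2,
      LinearlyConvergesTo (relaxedAltProj U V μ) (U ⊓ V).starProjection r) ↔
      μ ∈ Set.Ioo (1 : ℝ) (2 - (1 - friedrichsCos U V ^ 2)) := by
  have hc := friedrichsCos_sq_lt_one (U := U) (V := V)
  have hc0 := sq_nonneg (friedrichsCos U V)
  constructor
  · rintro ⟨r, hr, h⟩
    have h1 := (relaxedAltProjRate_le hV hμ ⟨_, h⟩).trans_lt hr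
    rw [relaxedAltProjRate, max_lt_iff, abs_lt, abs_lt] at h1
    refine ⟨?_, ?_⟩
    · nlinarith
    · linarith
  · rintro ⟨h1, h2⟩
    refine ⟨_, ?_, linearlyConvergesTo_relaxedAltProj ⟨by linarith, by linarith⟩⟩
    rw [relaxedAltProjRate, max_lt_iff, abs_lt, abs_lt]
    refine ⟨⟨?_, ?_⟩, ?_, ?_⟩ <;> nlinarith

/-- The rate is at least μ - 1 and at least 1 - μs; adding s times the first bound to the second
eliminates μ and leaves 1 - s. -/
lemma min_rate_le_relaxedAltProjRate :
    (1 - (1 - friedrichsCos U V ^ 2)) / (1 + (1 - friedrichsCos U V ^ 2)) ≤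
      relaxedAltProjRate U V μ := by
  have hc := friedrichsCos_sq_lt_one (U := U) (V := V)
  have h1 : μ - 1 ≤ relaxedAltProjRate U V μ :=
    (le_abs_self _).trans ((abs_sub_comm μ 1).trans_le (le_max_left _ _))
  have h2 : 1 - μ * (1 - friedrichsCos U V ^ 2) ≤ relaxedAltProjRate U V μ :=
    (le_abs_self _).trans (le_max_right _ _)
  rw [div_le_iff₀ (by linarith)]
  nlinarith

end Relaxed

theorem theorem3p6 {n : ℕ} (U V : Submodule ℝ (EuclideanSpace ℝ (Fin n)))
    (hU : 1 ≤ Module.finrank ℝ U)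
    (hUV : Module.finrank ℝ U ≤ Module.finrank ℝ V)
    (hV : Module.finrank ℝ V < n) :
    -- convergence of the powers
    (∀ μ : ℝ, PowersConvergent (relaxedAltProj U V μ) ↔ μ ∈ Set.Ico (0 : ℝ) 2) ∧
    -- (i)
    (∀ μ ∈ Set.Ioc (0 : ℝ) (2 / (1 + Real.sin (friedrichsAngle U V) ^ 2)),
      PowersConvergeTo (relaxedAltProj U V μ) (U ⊓ V).starProjection ∧
      IsOptimalConvergenceRate (relaxedAltProj U V μ)
        (subdominantModulus (relaxedAltProj U V μ)) ∧
      subdominantModulus (relaxedAltProj U V μ) =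
        1 - μ * Real.sin (friedrichsAngle U V) ^ 2) ∧
    -- (ii)
    (∀ μ ∈ Set.Ioo (2 / (1 + Real.sin (friedrichsAngle U V) ^ 2)) (2 : ℝ),
      PowersConvergeTo (relaxedAltProj U V μ) (U ⊓ V).starProjection ∧
      IsOptimalConvergenceRate (relaxedAltProj U V μ)
        (subdominantModulus (relaxedAltProj U V μ)) ∧
      subdominantModulus (relaxedAltProj U V μ) = μ - 1) ∧
    -- a rate smaller than the squared cosine of the Friedrichs angle
    (∀ μ : ℝ, μ ≠ 0 →
      ((∃ r < Real.cos (friedrichsAngle U V) ^ 2,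
          LinearlyConvergesTo (relaxedAltProj U V μ) (U ⊓ V).starProjection r) ↔
        μ ∈ Set.Ioo (1 : ℝ) (2 - Real.sin (friedrichsAngle U V) ^ 2))) ∧
    -- the smallest rate over all nonzero parameters, and where it is attained
    (IsOptimalConvergenceRate
        (relaxedAltProj U V (2 / (1 + Real.sin (friedrichsAngle U V) ^ 2)))
        ((1 - Real.sin (friedrichsAngle U V) ^ 2) /
          (1 + Real.sin (friedrichsAngle U V) ^ 2)) ∧
      ∀ μ : ℝ, μ ≠ 0 → ∀ r : ℝ, IsConvergenceRate (relaxedAltProj U V μ) r →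
        (1 - Real.sin (friedrichsAngle U V) ^ 2) /
          (1 + Real.sin (friedrichsAngle U V) ^ 2) ≤ r) := by
  rw [cos_friedrichsAngle, sin_sq_friedrichsAngle]
  have hc := friedrichsCos_sq_lt_one (U := U) (V := V)
  have hc0 := sq_nonneg (friedrichsCos U V)
  have hd : 0 < 1 + (1 - friedrichsCos U V ^ 2) := by linarith
  have hlt : 2 / (1 + (1 - friedrichsCos U V ^ 2)) < 2 := by
    rw [div_lt_iff₀ hd]; linarith
  have hpos : 0 < 2 / (1 + (1 - friedrichsCos U V ^ 2)) := by positivity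
  refine ⟨fun μ => powersConvergent_relaxedAltProj_iff hV, fun μ hμ => ?_, fun μ hμ => ?_,
    fun μ hμ => exists_rate_lt_friedrichsCos_sq_iff hV hμ, ?_,
    fun μ hμ r hr => min_rate_le_relaxedAltProjRate.trans (relaxedAltProjRate_le hV hμ hr)⟩
  · have hμ' : μ ∈ Set.Ioo (0 : ℝ) 2 := ⟨hμ.1, hμ.2.trans_lt hlt⟩
    rw [subdominantModulus_relaxedAltProj hV hμ.1.ne']
    exact ⟨(linearlyConvergesTo_relaxedAltProj hμ').powersConvergeTo,
      isOptimalConvergenceRate_relaxedAltProj hV hμ', relaxedAltProjRate_eq_of_le hμ.1 hμ.2⟩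
  · have hμ' : μ ∈ Set.Ioo (0 : ℝ) 2 := ⟨hpos.trans hμ.1, hμ.2⟩
    rw [subdominantModulus_relaxedAltProj hV hμ'.1.ne']
    exact ⟨(linearlyConvergesTo_relaxedAltProj hμ').powersConvergeTo,
      isOptimalConvergenceRate_relaxedAltProj hV hμ', relaxedAltProjRate_eq_of_ge hμ.1.le⟩
  · have h := isOptimalConvergenceRate_relaxedAltProj (U := U) hV ⟨hpos, hlt⟩
    -- At the threshold the rate is μ - 1 = 2 / (1 + s) - 1.
    rw [relaxedAltProjRate_eq_of_ge le_rfl] at h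
    convert h using 1
    field_simp
    ring
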